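/- Fuzzy rule for the subdifferential of the sum on $C^1$ Finsler manifolds. Setting. Let $X$ be a real Banach space admitting a $C^1$ Lipschitz bump function, i.e. a $C^1$ smooth Lipschitz function $b:X\to\mathbb R$ with bounded nonempty support. Let $M$ be a (paracompact, Hausdorff) connected $C^1$ Banach manifold modeled on $X$; charts $\varphi:U\subset M\to X$ are those of its maximal $C^1$ atlas. Let $\|\cdot\|_M:TM\to[0,\infty)$ be a Finsler structure in the sense of Palais, that is, a continuous map whose restriction $\|\cdot\|_x$ to each $T_xM$ is a norm such that (P1) for every $x\in M$ and every chart $(U,\varphi)$ with $x\in U$, the norm $v\mapsto\|d\varphi^{-1}(\varphi(x))(v)\|_x$ is equivalent to the norm $\|\cdot\|$ of $X$; (P2) for every $x_0\in M$, $\varepsilon>0$ and every chart $(U,\varphi)$ with $x_0\in U$, there is an open neighborhood $W\subset U$ of $x_0$ such that for all $x\in W$ and $v\in X$, $$\tfrac1{1+\varepsilon}\|d\varphi^{-1}(\varphi(x_0))(v)\|_{x_0}\le\|d\varphi^{-1}(\varphi(x))(v)\|_x\le(1+\varepsilon)\|d\varphi^{-1}(\varphi(x_0))(v)\|_{x_0}.$$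 Let $d(p,q)$ be the infimum of the lengths $\int_a^b\|c'(t)\|_{c(t)}\,dt$ over all piecewise $C^1$ paths $c:[a,b]\to M$ from $p$ to $q$. For $f:M\to\mathbb R$ and $x\in M$ let $$D^-f(x)=\{dh(x)\,:\,h:M\to\mathbb R\text{ is }C^1\text{ smooth and }f-h\text{ attains a local minimum at }x\}\subset T_xM^*.$$ Statement. Let $f,g:M\to\mathbb R$, where $f$ is lower semicontinuous and $g$ is locally uniformly continuous (every point of $M$ has a neighborhood on which $g$ is uniformly continuous for $d$). Then for every $x\in M$, every chart $(U,\varphi)$ with $x\in U$, every $\Delta\in D^-(f+g)(x)$ and every $\varepsilon>0$, there exist $x_1,x_2\in U$, $\Delta_1\in D^-f(x_1)$ and $\Delta_2\in D^-g(x_2)$ such that 1. $d(x_1,x)<\varepsilon$ and $d(x_2,x)<\varepsilon$; 2. $|f(x_1)-f(x)|<\varepsilon$ and $|g(x_2)-g(x)|<\varepsilon$; 3. $\|\Delta_1\circ d\varphi(x_1)^{-1}+\Delta_2\circ d\varphi(x_2)^{-1}-\Delta\circ d\varphi(x)^{-1}\|<\varepsilon$; 4. $d(x_1,x_2)\cdot\max\{\|\Delta_1\circ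 d\varphi(x_1)^{-1}\|,\ \|\Delta_2\circ d\varphi(x_2)^{-1}\|\}<\varepsilon$, where the norms in 3 and 4 are the dual norm of $X^*$. -/

import Mathlib

open Set Filter Topology Manifold

noncomputable section

/-- `X` admits a `C¹` Lipschitz bump function: a `C¹` smooth, Lipschitz function `X → ℝ` whose
support is bounded and nonempty. -/
def HasC1LipschitzBump (X : Type*) [NormedAddCommGroup X] [NormedSpace ℝ X] : Prop :=
  ∃ b : X → ℝ, ContDiff ℝ 1 b ∧ (∃ L, LipschitzWith L b) ∧
    Bornology.IsBounded (tsupport b) ∧ (tsupport b).Nonempty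

section Manifold

variable {X : Type*} [NormedAddCommGroup X] [NormedSpace ℝ X]
variable {M : Type*} [TopologicalSpace M] [ChartedSpace X M]

/-- The derivative `dφ⁻¹(φ(x)) : X → T_x M` of the inverse of a chart `φ` around `x`, that is,
the inverse `dφ(x)⁻¹` of the differential of `φ` at `x` (used only for `x ∈ φ.source`, where
`φ.symm (φ x) = x`). -/
def chartInvDeriv (φ : OpenPartialHomeomorph M X) (x : M) :
    X →L[ℝ] TangentSpace 𝓘(ℝ, X) x :=
  mfderiv 𝓘(ℝ, X) 𝓘(ℝ, X) φ.symm (φ x)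

variable (X M) in
/-- A Finsler structure in the sense of Palais on a `C¹` manifold `M` modeled on `X`. The charts
are all the charts of the maximal `C¹` atlas of `M`. -/
structure FinslerStructure [IsManifold 𝓘(ℝ, X) 1 M] where
  /-- the norm `‖·‖_x` on the tangent space `T_x M` -/
  norm : ∀ x : M, Seminorm ℝ (TangentSpace 𝓘(ℝ, X) x)
  /-- `‖·‖_x` is definite -/
  eq_zero_of_norm_eq_zero : ∀ (x : M) (v : TangentSpace 𝓘(ℝ, X) x), norm x v = 0 → v = 0
  /-- `‖·‖_M : TM → [0, ∞)` is continuous -/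
  continuous_norm : Continuous fun p : TangentBundle 𝓘(ℝ, X) M => norm p.proj p.snd
  /-- in every chart around `x`, the norm `‖·‖_x` is equivalent to the norm of `X` -/
  equivalent : ∀ φ ∈ IsManifold.maximalAtlas 𝓘(ℝ, X) 1 M, ∀ x ∈ φ.source,
    ∃ K : ℝ, 1 ≤ K ∧ ∀ v : X, 1 / K * ‖v‖ ≤ norm x (chartInvDeriv φ x v) ∧
      norm x (chartInvDeriv φ x v) ≤ K * ‖v‖
  /-- the Palais condition -/
  palais : ∀ φ ∈ IsManifold.maximalAtlas 𝓘(ℝ, X) 1 M, ∀ x₀ ∈ φ.source, ∀ ε : ℝ, 0 < ε →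
    ∃ W : Set M, IsOpen W ∧ x₀ ∈ W ∧ W ⊆ φ.source ∧ ∀ x ∈ W, ∀ v : X,
      1 / (1 + ε) * norm x₀ (chartInvDeriv φ x₀ v) ≤ norm x (chartInvDeriv φ x v) ∧
      norm x (chartInvDeriv φ x v) ≤ (1 + ε) * norm x₀ (chartInvDeriv φ x₀ v)

variable (X) in
/-- `c : [a, b] → M` is a piecewise `C¹` smooth path: it is continuous, and `C¹` smooth on each
interval of some finite partition `a = t 0 ≤ t 1 ≤ ⋯ ≤ t n = b`. -/
def IsPiecewiseC1Path (c : ℝ → M) (a b : ℝ) : Prop :=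
  ContinuousOn c (Icc a b) ∧ ∃ (n : ℕ) (t : ℕ → ℝ), t 0 = a ∧ t n = b ∧
    ∀ i < n, t i ≤ t (i + 1) ∧ ContMDiffOn 𝓘(ℝ, ℝ) 𝓘(ℝ, X) 1 c (Icc (t i) (t (i + 1)))

variable (X) in
/-- The velocity `c'(t) ∈ T_{c(t)} M` of a path. -/
def velocity (c : ℝ → M) (t : ℝ) : TangentSpace 𝓘(ℝ, X) (c t) :=
  mfderiv 𝓘(ℝ, ℝ) 𝓘(ℝ, X) c t (1 : ℝ)

namespace FinslerStructure

variable [IsManifold 𝓘(ℝ, X) 1 M]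

/-- The length `∫_a^b ‖c'(t)‖_{c(t)} dt` of a piecewise `C¹` path. -/
def length (F : FinslerStructure X M) (c : ℝ → M) (a b : ℝ) : ℝ :=
  ∫ t in a..b, F.norm (c t) (velocity X c t)

/-- The Finsler metric: the infimum of the lengths of the piecewise `C¹` paths from `p` to `q`
(such paths exist when `M` is connected). -/
def dist (F : FinslerStructure X M) (p q : M) : ℝ :=
  sInf {r : ℝ | ∃ (c : ℝ → M) (a b : ℝ), a ≤ b ∧ IsPiecewiseC1Path X c a b ∧
    c a = p ∧ c b = q ∧ r = F.length c a b}

/-- `g` is locally uniformly continuous for the Finsler metric: every point has a neighborhood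
on which `g` is uniformly continuous. -/
def LocallyUniformlyContinuous (F : FinslerStructure X M) (g : M → ℝ) : Prop :=
  ∀ x : M, ∃ V ∈ 𝓝 x, ∀ ε : ℝ, 0 < ε → ∃ δ : ℝ, 0 < δ ∧
    ∀ y ∈ V, ∀ z ∈ V, F.dist y z < δ → |g y - g z| < ε

end FinslerStructure

variable (X) in
/-- The set `D⁻f(x) ⊆ T_x M*` of subdifferentials of `f : M → ℝ` at `x`: the differentials at `x`
of the `C¹` smooth `h : M → ℝ` such that `f - h` attains a local minimum at `x`. -/
def subdifferential (f : M → ℝ) (x : M) : Set (TangentSpace 𝓘(ℝ, X) x →L[ℝ] ℝ) :=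
  {Δ | ∃ h : M → ℝ, ContMDiff 𝓘(ℝ, X) 𝓘(ℝ, ℝ) 1 h ∧
    IsLocalMin (fun y => f y - h y) x ∧ Δ = mfderiv 𝓘(ℝ, X) 𝓘(ℝ, ℝ) h x}

end Manifold

end

/-! The problem is local, so it is moved to `X` by the chart and solved there. If `F + G - H` has a
local minimum at `p`, decouple the variables: minimize `F u + G v - H u` minus two bumps, one
rewarding `u` near `p`, the other, rescaled to width `s`, rewarding `u` near `v`. Since `E × E` need
not be locally compact, the minimum is produced by the Deville–Godefroy–Zizler principle
(`IsUnitBump.exists_contDiff_isMinOn`) after a `C¹`-small perturbation. Freezing one variable gives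
the two subgradients. The coupling bump contributes opposite terms of size `O(η / s)`: they cancel
in the sum, and since `‖u - v‖ < s` their product with the distance is only `O(η)`.

For the return to `M`, germs of `C¹` functions extend globally by cutoffs
(`exists_contMDiff_eventuallyEq_comp_chart`), and the Finsler metric is at most a multiple of the
chart norm (`FinslerStructure.exists_dist_chart_symm_le`). This one-sided comparison serves both the
distance estimates and the uniform continuity of `g` in the chart. -/

/-! ### Normalized bump functions. -/

/-- `β` is a `C¹` bump function on the unit ball with values in `[0, 1]`, maximal at the origin,
whose derivative is bounded by `L`. -/
structure IsUnitBump {E : Type*} [NormedAddCommGroup E] [NormedSpace ℝ E]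
    (β : E → ℝ) (L : ℝ) : Prop where
  contDiff : ContDiff ℝ 1 β
  nonneg : ∀ w, 0 ≤ β w
  le_one : ∀ w, β w ≤ 1
  map_zero : β 0 = 1
  eq_zero : ∀ w, 1 ≤ ‖w‖ → β w = 0
  norm_fderiv_le : ∀ w, ‖fderiv ℝ β w‖ ≤ L

/-- After recentring and rescaling, `q 0 = 1`, but `q` may change sign or exceed 1. Composing with
`θ t = (2t / (1 + t²))²` repairs this: `θ` has values in `[0, 1]`, bounded derivative, `θ 0 = 0` and
`θ 1 = 1`. -/
theorem HasC1LipschitzBump.exists_isUnitBump {E : Type*} [NormedAddCommGroup E] [NormedSpace ℝ E]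
    (hE : HasC1LipschitzBump E) : ∃ (β : E → ℝ) (L : ℝ), 0 ≤ L ∧ IsUnitBump β L := by
  obtain ⟨b, hb, ⟨K, hK⟩, hbd, hne⟩ := hE
  obtain ⟨z, hz⟩ : (Function.support b).Nonempty := by
    rw [tsupport, closure_nonempty_iff] at hne
    exact hne
  obtain ⟨R, hR0, hR⟩ := hbd.subset_ball_lt 0 z
  have hz' : b z ≠ 0 := hz
  set q : E → ℝ := fun w => b (z + R • w) / b z with hq
  have hqc : ContDiff ℝ 1 q := by
    refine ContDiff.div_const (hb.comp ?_) _
    exact contDiff_const.add (contDiff_const.smul contDiff_id)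
  have hqd : ∀ w, HasFDerivAt q ((b z)⁻¹ • (fderiv ℝ b (z + R • w)).comp
      (R • ContinuousLinearMap.id ℝ E)) w := by
    intro w
    have h1 : HasFDerivAt (fun w : E => z + R • w) (R • ContinuousLinearMap.id ℝ E) w :=
      ((hasFDerivAt_id w).const_smul R).const_add z
    have h2 := ((hb.differentiable (by norm_num) (z + R • w)).hasFDerivAt.comp w h1).const_mul
      ((b z)⁻¹)
    refine h2.congr_of_eventuallyEq (Eventually.of_forall fun y => ?_)
    simp [hq, div_eq_inv_mul]
  have hqn : ∀ w, ‖fderiv ℝ q w‖ ≤ |(b z)⁻¹| * (K * R) := by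
    intro w
    rw [(hqd w).fderiv, norm_smul, Real.norm_eq_abs]
    refine mul_le_mul_of_nonneg_left ?_ (abs_nonneg _)
    refine (ContinuousLinearMap.opNorm_comp_le _ _).trans ?_
    refine mul_le_mul (norm_fderiv_le_of_lipschitz ℝ hK) ?_ (norm_nonneg _) K.2
    rw [norm_smul, Real.norm_eq_abs, abs_of_pos hR0]
    exact mul_le_of_le_one_right hR0.le ContinuousLinearMap.norm_id_le
  have hpos : ∀ t : ℝ, 0 < 1 + t ^ 2 := fun t => by positivity
  set θ : ℝ → ℝ := fun t => (2 * t / (1 + t ^ 2)) ^ 2 with hθ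
  have hθc : ContDiff ℝ 1 θ := by
    refine ContDiff.pow (ContDiff.div ?_ ?_ fun t => (hpos t).ne') 2 <;> fun_prop
  have hθd : ∀ t, HasDerivAt θ (2 * (2 * t / (1 + t ^ 2)) *
      (2 * (1 - t ^ 2) / (1 + t ^ 2) ^ 2)) t := by
    intro t
    have h1 : HasDerivAt (fun t : ℝ => 2 * t) 2 t := by simpa using (hasDerivAt_id t).const_mul 2
    have h2 : HasDerivAt (fun t : ℝ => 1 + t ^ 2) (2 * t) t := by
      simpa using (hasDerivAt_pow 2 t).const_add 1
    refine ((h1.div h2 (hpos t).ne').pow 2).congr_deriv ?_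
    have := (hpos t).ne'
    simp only [Pi.div_apply, Nat.cast_ofNat, Nat.reduceSub, pow_one]
    field_simp
    ring
  have habs : ∀ t : ℝ, |2 * t / (1 + t ^ 2)| ≤ 1 := by
    intro t
    rw [abs_div, abs_of_pos (hpos t), div_le_one (hpos t), abs_le]
    constructor <;> nlinarith [sq_nonneg (t - 1), sq_nonneg (t + 1)]
  have habs' : ∀ t : ℝ, |2 * (1 - t ^ 2) / (1 + t ^ 2) ^ 2| ≤ 2 := by
    intro t
    rw [abs_div, abs_of_pos (pow_pos (hpos t) 2), div_le_iff₀ (pow_pos (hpos t) 2), abs_le]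
    constructor <;> nlinarith [sq_nonneg t, sq_nonneg (t ^ 2)]
  have hθn : ∀ t : ℝ, |2 * (2 * t / (1 + t ^ 2)) * (2 * (1 - t ^ 2) / (1 + t ^ 2) ^ 2)| ≤ 4 := by
    intro t
    rw [abs_mul, abs_mul, abs_two]
    nlinarith [habs t, habs' t, abs_nonneg (2 * t / (1 + t ^ 2)),
      abs_nonneg (2 * (1 - t ^ 2) / (1 + t ^ 2) ^ 2)]
  have hL : 0 ≤ |(b z)⁻¹| * (K * R) := by positivity
  refine ⟨fun w => θ (q w), 4 * (|(b z)⁻¹| * (K * R)), by positivity, ?_⟩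
  refine ⟨hθc.comp hqc, fun w => sq_nonneg _, fun w => ?_, ?_, fun w hw => ?_, fun w => ?_⟩
  · exact (sq_le_one_iff_abs_le_one _).2 (habs _)
  · simp only [hθ, hq, smul_zero, add_zero, div_self hz']
    norm_num
  · have : b (z + R • w) = 0 := by
      by_contra hne
      have := hR (subset_tsupport b hne)
      rw [mem_ball_iff_norm, add_sub_cancel_left, norm_smul, Real.norm_eq_abs,
        abs_of_pos hR0] at this
      nlinarith
    simp [hθ, hq, this]
  · have h := (hθd (q w)).comp_hasFDerivAt w (hqc.differentiable (by norm_num) w).hasFDerivAt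
    change ‖fderiv ℝ (θ ∘ q) w‖ ≤ _
    rw [h.fderiv, norm_smul, Real.norm_eq_abs]
    exact mul_le_mul (hθn _) (hqn w) (norm_nonneg _) (by norm_num)

theorem IsUnitBump.prod {E G : Type*} [NormedAddCommGroup E] [NormedSpace ℝ E]
    [NormedAddCommGroup G] [NormedSpace ℝ G] {β : E → ℝ} {γ : G → ℝ} {L N : ℝ}
    (hβ : IsUnitBump β L) (hγ : IsUnitBump γ N) :
    IsUnitBump (fun z : E × G => β z.1 * γ z.2) (L + N) := by
  refine ⟨(hβ.contDiff.comp contDiff_fst).mul (hγ.contDiff.comp contDiff_snd),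
    fun w => mul_nonneg (hβ.nonneg _) (hγ.nonneg _),
    fun w => mul_le_one₀ (hβ.le_one _) (hγ.nonneg _) (hγ.le_one _), ?_, fun w hw => ?_,
    fun w => ?_⟩
  · simp [hβ.map_zero, hγ.map_zero]
  · rcases le_max_iff.1 (Prod.norm_def w ▸ hw) with h | h
    · simp [hβ.eq_zero _ h]
    · simp [hγ.eq_zero _ h]
  · have h1 : HasFDerivAt (fun z : E × G => β z.1)
        ((fderiv ℝ β w.1).comp (ContinuousLinearMap.fst ℝ E G)) w :=
      (hβ.contDiff.differentiable (by norm_num) w.1).hasFDerivAt.comp w hasFDerivAt_fst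
    have h2 : HasFDerivAt (fun z : E × G => γ z.2)
        ((fderiv ℝ γ w.2).comp (ContinuousLinearMap.snd ℝ E G)) w :=
      (hγ.contDiff.differentiable (by norm_num) w.2).hasFDerivAt.comp w hasFDerivAt_snd
    rw [HasFDerivAt.fderiv (f := fun z : E × G => β z.1 * γ z.2) (h1.mul h2), add_comm L N]
    have n1 : ‖(fderiv ℝ β w.1).comp (ContinuousLinearMap.fst ℝ E G)‖ ≤ L :=
      ((ContinuousLinearMap.opNorm_comp_le _ _).trans (mul_le_of_le_one_right (norm_nonneg _)
        (ContinuousLinearMap.norm_fst_le _ _ _))).trans (hβ.norm_fderiv_le _)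
    have n2 : ‖(fderiv ℝ γ w.2).comp (ContinuousLinearMap.snd ℝ E G)‖ ≤ N :=
      ((ContinuousLinearMap.opNorm_comp_le _ _).trans (mul_le_of_le_one_right (norm_nonneg _)
        (ContinuousLinearMap.norm_snd_le _ _ _))).trans (hγ.norm_fderiv_le _)
    refine (norm_add_le _ _).trans (add_le_add ?_ ?_)
    · rw [norm_smul, Real.norm_eq_abs, abs_of_nonneg (hβ.nonneg _)]
      exact (mul_le_of_le_one_left (norm_nonneg _) (hβ.le_one _)).trans n2
    · rw [norm_smul, Real.norm_eq_abs, abs_of_nonneg (hγ.nonneg _)]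
      exact (mul_le_of_le_one_left (norm_nonneg _) (hγ.le_one _)).trans n1

/-- A rescaled and translated bump. -/
theorem IsUnitBump.hasFDerivAt_scale {E : Type*} [NormedAddCommGroup E] [NormedSpace ℝ E]
    {β : E → ℝ} {L : ℝ} (hβ : IsUnitBump β L) (t : ℝ) (p w : E) :
    HasFDerivAt (fun z => β (t • (z - p))) (t • fderiv ℝ β (t • (w - p))) w := by
  have h1 : HasFDerivAt (fun z : E => t • (z - p)) (t • ContinuousLinearMap.id ℝ E) w :=
    ((hasFDerivAt_id w).sub_const p).const_smul t
  refine ((hβ.contDiff.differentiable (by norm_num) _).hasFDerivAt.comp w h1).congr_fderiv ?_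
  ext v
  simp

/-! ### The smooth variational principle. -/

/-- **Smooth variational principle** of Deville, Godefroy and Zizler. -/
theorem IsUnitBump.exists_contDiff_isMinOn {E : Type*} [NormedAddCommGroup E] [NormedSpace ℝ E]
    [CompleteSpace E] {β : E → ℝ} {L : ℝ} (hβ : IsUnitBump β L) {C : Set E} (hC : IsClosed C)
    (hCne : C.Nonempty) {f : E → ℝ} (hf : LowerSemicontinuousOn f C) {m : ℝ}
    (hm : ∀ z ∈ C, m ≤ f z) {ε : ℝ} (hε : 0 < ε) :
    ∃ ψ : E → ℝ, ContDiff ℝ 1 ψ ∧ (∀ z, |ψ z| ≤ ε) ∧ (∀ z, ‖fderiv ℝ ψ z‖ ≤ ε) ∧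
      ∃ y ∈ C, ∀ z ∈ C, f y - ψ y ≤ f z - ψ z := by
  have hL : 0 ≤ L := (norm_nonneg _).trans (hβ.norm_fderiv_le 0)
  set κ : ℝ := ε / (2 * (1 + L)) with hκ
  have hκ0 : 0 < κ := by positivity
  have hκL : κ * (1 + L) = ε / 2 := by rw [hκ]; field_simp
  -- With ratio 1/8 the coefficients beat the factors `2 ^ k` that differentiation brings out, and
  -- the tail after index `n` is only `c n / 7`.
  set c : ℕ → ℝ := fun k => κ * (1 / 8) ^ k with hc
  have hc0 : ∀ k, 0 < c k := fun k => by positivity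
  have hcs : ∀ k, c (k + 1) = c k / 8 := fun k => by simp only [hc, pow_succ]; ring
  have hcsum : HasSum c (κ * (8 / 7)) := by
    have := (hasSum_geometric_of_lt_one (r := (1 / 8 : ℝ)) (by norm_num) (by norm_num)).mul_left κ
    norm_num at this ⊢
    simpa [hc] using this
  set S : (ℕ → E) → ℕ → E → ℝ :=
    fun x n z => ∑ k ∈ Finset.range n, c k * β ((2 : ℝ) ^ k • (z - x k)) with hS
  have hSsucc : ∀ x n z, S x (n + 1) z = S x n z + c n * β ((2 : ℝ) ^ n • (z - x n)) :=
    fun x n z => Finset.sum_range_succ _ _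
  have hterm0 : ∀ k w, 0 ≤ c k * β w := fun k w => mul_nonneg (hc0 k).le (hβ.nonneg w)
  have hterm1 : ∀ k w, c k * β w ≤ c k := fun k w =>
    mul_le_of_le_one_right (hc0 k).le (hβ.le_one w)
  have hSle : ∀ x n z, S x n z ≤ κ * (8 / 7) := fun x n z =>
    (Finset.sum_le_sum fun k _ => hterm1 k _).trans
      (sum_le_hasSum _ (fun k _ => (hc0 k).le) hcsum)
  obtain ⟨x, hx⟩ : ∃ x : ℕ → E, ∀ n, x n ∈ C ∧
      ∀ z ∈ C, f (x n) - S x n (x n) ≤ f z - S x n z + c n / 2 := by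
    -- The lower bound is a premise inside the existential so that `choose` gives a total selector;
    -- the point is an arbitrary 0 when `g` is unbounded below on `C`.
    have key : ∀ (n : ℕ) (g : E → ℝ), ∃ p : E, (∃ B, ∀ z ∈ C, B ≤ g z) →
        p ∈ C ∧ ∀ z ∈ C, g p ≤ g z + c n / 2 := by
      intro n g
      by_cases hB : ∃ B, ∀ z ∈ C, B ≤ g z
      · obtain ⟨B, hB⟩ := hB
        have hbdd : BddBelow (g '' C) := ⟨B, by rintro _ ⟨z, hz, rfl⟩; exact hB z hz⟩
        obtain ⟨_, ⟨p, hp, rfl⟩, hlt⟩ := exists_lt_of_csInf_lt (hCne.image g)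
          (lt_add_of_pos_right (sInf (g '' C)) (half_pos (hc0 n)))
        exact ⟨p, fun _ => ⟨hp, fun z hz => hlt.le.trans
          (add_le_add_left (csInf_le hbdd (mem_image_of_mem g hz)) _)⟩⟩
      · exact ⟨0, fun h => absurd h hB⟩
    choose P hP using key
    let g : ℕ → E → ℝ := fun n => Nat.rec f
      (fun n g z => g z - c n * β ((2 : ℝ) ^ n • (z - P n g))) n
    have hg : ∀ n z, g n z = f z - S (fun k => P k (g k)) n z := by
      intro n z
      induction n with
      | zero => simp [hS, g]
      | succ n ih =>
        rw [hSsucc, ← sub_sub, ← ih]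
    refine ⟨fun k => P k (g k), fun n => ?_⟩
    have := hP n (g n) ⟨m - κ * (8 / 7), fun z hz => by
      rw [hg]; linarith [hm z hz, hSle (fun k => P k (g k)) n z]⟩
    refine ⟨this.1, fun z hz => ?_⟩
    rw [← hg, ← hg]
    exact this.2 z hz
  have hmono : ∀ z, Monotone fun n => S x n z := fun z => monotone_nat_of_le_succ fun n => by
    rw [hSsucc]; linarith [hterm0 n ((2 : ℝ) ^ n • (z - x n))]
  have hanti : ∀ z, Antitone fun n => S x n z + 8 / 7 * c n := fun z =>
    antitone_nat_of_succ_le fun n => by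
      rw [hSsucc, hcs]; linarith [hterm1 n ((2 : ℝ) ^ n • (z - x n))]
  have hcanti : Antitone c := antitone_nat_of_succ_le fun n => by
    rw [hcs]; linarith [hc0 n]
  -- The bump centred at `x n` lowers the value there by `c n`. A later `x k` outside its support
  -- would forgo this gain; the selection error `c n / 2` and the later bumps, at most `c n / 7`,
  -- cannot make up for it.
  have hnear : ∀ n k, n < k → ‖x k - x n‖ < (1 / 2) ^ n := by
    intro n k hnk
    by_contra! hge
    have h0 : β ((2 : ℝ) ^ n • (x k - x n)) = 0 := by
      refine hβ.eq_zero _ ?_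
      rw [norm_smul, norm_pow, Real.norm_two]
      calc (1 : ℝ) = 2 ^ n * (1 / 2) ^ n := by rw [← mul_pow]; norm_num
        _ ≤ _ := by gcongr
    have h1 : β ((2 : ℝ) ^ n • (x n - x n)) = 1 := by simp [hβ.map_zero]
    have e1 := hSsucc x n (x k)
    have e2 := hSsucc x n (x n)
    rw [h0] at e1
    rw [h1] at e2
    have m1 : S x (n + 1) (x n) ≤ S x k (x n) := hmono (x n) hnk
    have m2 : S x k (x k) + 8 / 7 * c k ≤ S x (n + 1) (x k) + 8 / 7 * c (n + 1) :=
      hanti (x k) hnk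
    have m3 : c k ≤ c (n + 1) := hcanti hnk
    have m4 := (hx k).2 (x n) (hx n).1
    have m5 := (hx n).2 (x k) (hx k).1
    have := hcs n
    linarith [hc0 n, hc0 k]
  have hcauchy : CauchySeq x := by
    refine cauchySeq_of_le_tendsto_0 (fun n => 2 * (1 / 2 : ℝ) ^ n) (fun n k N hn hk => ?_) ?_
    · have key : ∀ n, N ≤ n → dist (x n) (x N) ≤ (1 / 2 : ℝ) ^ N := by
        intro n hn
        rcases hn.eq_or_lt with rfl | h
        · simp
        · rw [dist_eq_norm]; exact (hnear N n h).le
      have := dist_triangle_right (x n) (x k) (x N)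
      linarith [key n hn, key k hk]
    · simpa using (tendsto_pow_atTop_nhds_zero_of_lt_one (r := (1 / 2 : ℝ)) (by norm_num)
        (by norm_num)).const_mul 2
  obtain ⟨y, hy⟩ := cauchySeq_tendsto_of_complete hcauchy
  have hyC : y ∈ C := hC.mem_of_tendsto hy (Eventually.of_forall fun n => (hx n).1)
  set ψ : E → ℝ := fun z => ∑' k, c k * β ((2 : ℝ) ^ k • (z - x k)) with hψ
  have hsummable : ∀ z, Summable fun k => c k * β ((2 : ℝ) ^ k • (z - x k)) := fun z =>
    Summable.of_nonneg_of_le (fun k => hterm0 k _) (fun k => hterm1 k _) hcsum.summable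
  have hSψ : ∀ z, Tendsto (fun n => S x n z) atTop (𝓝 (ψ z)) := fun z =>
    (hsummable z).hasSum.tendsto_sum_nat
  have hSleψ : ∀ n z, S x n z ≤ ψ z := fun n z => (hmono z).ge_of_tendsto (hSψ z) n
  set u : ℕ → ℝ := fun k => κ * L * (1 / 4) ^ k with hu
  have husum : HasSum u (κ * L * (4 / 3)) := by
    have := (hasSum_geometric_of_lt_one (r := (1 / 4 : ℝ)) (by norm_num)
      (by norm_num)).mul_left (κ * L)
    norm_num at this ⊢
    simpa [hu] using this
  set D : ℕ → E → E →L[ℝ] ℝ :=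
    fun k z => c k • ((2 : ℝ) ^ k • fderiv ℝ β ((2 : ℝ) ^ k • (z - x k))) with hD
  have hDn : ∀ k z, ‖D k z‖ ≤ u k := by
    intro k z
    rw [hD, norm_smul, norm_smul, norm_pow, Real.norm_two, Real.norm_eq_abs, abs_of_pos (hc0 k)]
    calc c k * (2 ^ k * ‖fderiv ℝ β ((2 : ℝ) ^ k • (z - x k))‖)
        ≤ c k * (2 ^ k * L) := by
          gcongr; exact hβ.norm_fderiv_le _
      _ = κ * L * ((1 / 8) ^ k * 2 ^ k) := by simp only [hc]; ring
      _ = u k := by rw [← mul_pow, hu]; norm_num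
  have hψd : ∀ z, HasFDerivAt ψ (∑' k, D k z) z := fun z =>
    hasFDerivAt_tsum husum.summable
      (fun k z => (hβ.hasFDerivAt_scale _ _ z).const_mul (c k)) hDn (hsummable y) z
  have hψf : fderiv ℝ ψ = fun z => ∑' k, D k z := funext fun z => (hψd z).fderiv
  have hψc : ContDiff ℝ 1 ψ := by
    rw [contDiff_one_iff_fderiv]
    refine ⟨fun z => (hψd z).differentiableAt, ?_⟩
    rw [hψf]
    refine continuous_tsum (fun k => ?_) husum.summable hDn
    have := hβ.contDiff.continuous_fderiv (by norm_num)
    fun_prop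
  refine ⟨ψ, hψc, fun z => ?_, fun z => ?_, y, hyC, fun z hz => ?_⟩
  · have h1 : ψ z ≤ κ * (8 / 7) := le_of_tendsto' (hSψ z) fun n => hSle x n z
    have h0 : 0 ≤ ψ z := by simpa [hS] using hSleψ 0 z
    rw [abs_of_nonneg h0]
    nlinarith
  · rw [hψf]
    refine (tsum_of_norm_bounded husum fun k => hDn k z).trans ?_
    nlinarith
  · by_contra! hlt
    -- A quarter of the gap: semicontinuity of `f`, continuity of `ψ`, convergence of `S x n z` and
    -- the selection error each cost less than `δ`.
    obtain ⟨δ, hδ0, hδ⟩ : ∃ δ, 0 < δ ∧ (f z - ψ z) + 4 * δ = f y - ψ y :=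
      ⟨(f y - ψ y - (f z - ψ z)) / 4, by linarith, by ring⟩
    have hyw : Tendsto x atTop (𝓝[C] y) :=
      tendsto_nhdsWithin_iff.2 ⟨hy, Eventually.of_forall fun n => (hx n).1⟩
    have a1 : ∀ᶠ n in atTop, f y - δ < f (x n) := hyw.eventually (hf y hyC _ (by linarith))
    have a2 : ∀ᶠ n in atTop, ψ (x n) < ψ y + δ :=
      (hψc.continuous.continuousAt.tendsto.comp hy).eventually_lt_const (by linarith)
    have a3 : ∀ᶠ n in atTop, ψ z - δ < S x n z := (hSψ z).eventually_const_lt (by linarith)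
    have a4 : ∀ᶠ n in atTop, c n < δ :=
      hcsum.summable.tendsto_atTop_zero.eventually_lt_const hδ0
    obtain ⟨n, b1, b2, b3, b4⟩ := (a1.and (a2.and (a3.and a4))).exists
    linarith [(hx n).2 z hz, hSleψ n (x n)]

/-! ### The fuzzy sum rule in a Banach space. -/

/-- **Fuzzy sum rule** in a Banach space with a `C¹` Lipschitz bump. -/
theorem IsUnitBump.fuzzy_sum_rule {E : Type*} [NormedAddCommGroup E] [NormedSpace ℝ E]
    [CompleteSpace E] {β : E → ℝ} {L : ℝ} (hβ : IsUnitBump β L) {F G H : E → ℝ} {p : E}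
    (hF : ∀ᶠ y in 𝓝 p, LowerSemicontinuousAt F y) {V : Set E} (hV : V ∈ 𝓝 p)
    (hG : UniformContinuousOn G V) (hH : ContDiffAt ℝ 1 H p)
    (hmin : IsLocalMin (fun y => F y + G y - H y) p) {U : Set E} (hU : U ∈ 𝓝 p)
    {ε : ℝ} (hε : 0 < ε) :
    ∃ u ∈ U, ∃ v ∈ U, ∃ h k : E → ℝ, ContDiffAt ℝ 1 h u ∧ ContDiffAt ℝ 1 k v ∧
      IsLocalMin (fun y => F y - h y) u ∧ IsLocalMin (fun y => G y - k y) v ∧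
      |F u - F p| < ε ∧ |G v - G p| < ε ∧
      ‖fderiv ℝ h u + fderiv ℝ k v - fderiv ℝ H p‖ < ε ∧
      ‖u - v‖ * max ‖fderiv ℝ h u‖ ‖fderiv ℝ k v‖ < ε := by
  have hL : 0 ≤ L := (norm_nonneg _).trans (hβ.norm_fderiv_le 0)
  obtain ⟨η, hη0, hηL⟩ : ∃ η, 0 < η ∧ η * (L + 1) = ε / 16 :=
    ⟨ε / 16 / (L + 1), by positivity, by field_simp⟩
  have hηL' : η * L ≤ ε / 16 := by nlinarith
  have hηε : η ≤ ε / 16 := by nlinarith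
  have hVG : ContinuousAt G p := hG.continuousOn.continuousAt hV
  have hH' : ContinuousAt (fderiv ℝ H) p := hH.continuousAt_fderiv (by norm_num)
  have hev : ∀ᶠ y in 𝓝 p, LowerSemicontinuousAt F y ∧ ContDiffAt ℝ 1 H y ∧ y ∈ V ∧ y ∈ U ∧
      F p + G p - H p ≤ F y + G y - H y ∧ F p - η < F y ∧ |G y - G p| < η ∧ |H y - H p| < η ∧
      ‖fderiv ℝ H y - fderiv ℝ H p‖ < ε / 4 := by
    refine hF.and ((hH.eventually (by simp)).and (Filter.Eventually.and hV
      (Filter.Eventually.and hU (hmin.and ((hF.self_of_nhds _ (by linarith)).and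
      (Filter.Eventually.and ?_ (Filter.Eventually.and ?_ ?_)))))))
    · exact Metric.tendsto_nhds.1 hVG η hη0
    · exact Metric.tendsto_nhds.1 hH.continuousAt η hη0
    · simpa only [dist_eq_norm] using Metric.tendsto_nhds.1 hH' (ε / 4) (by positivity)
  obtain ⟨ρ, hρ0, hρ⟩ := Metric.nhds_basis_closedBall.mem_iff.1 hev
  obtain ⟨r, hr0, hrρ⟩ : ∃ r, 0 < r ∧ r + r = ρ := ⟨ρ / 2, by positivity, by ring⟩
  -- Taking `a ≤ r * η` keeps the slope `a * L / r` of the localizing bump small. The tolerances `a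
  -- / 4` for `G` and `σ ≤ a / 8` are then chosen below its height.
  obtain ⟨a, ha0, haη, har⟩ : ∃ a, 0 < a ∧ a ≤ η ∧ r⁻¹ * (a * L) ≤ ε / 16 := by
    refine ⟨min η (r * η), lt_min hη0 (mul_pos hr0 hη0), min_le_left _ _, ?_⟩
    calc r⁻¹ * (min η (r * η) * L) ≤ r⁻¹ * (r * η * L) := by gcongr; exact min_le_right _ _
      _ = η * L := by field_simp
      _ ≤ _ := hηL'
  obtain ⟨δ, hδ0, hδ⟩ := Metric.uniformContinuousOn_iff.1 hG (a / 4) (by positivity)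
  obtain ⟨s, hs0, hsδ, hsr, hsN⟩ : ∃ s, 0 < s ∧ s ≤ δ ∧ s ≤ r ∧
      s * (‖fderiv ℝ H p‖ + ε) ≤ ε / 4 := by
    have hpos : 0 < ‖fderiv ℝ H p‖ + ε := by positivity
    refine ⟨min δ (min r (ε / 4 / (‖fderiv ℝ H p‖ + ε))), by positivity, min_le_left _ _,
      (min_le_right _ _).trans (min_le_left _ _), ?_⟩
    rw [← le_div_iff₀ hpos]
    exact (min_le_right _ _).trans (min_le_right _ _)
  obtain ⟨σ, hσ0, hσa, hσε⟩ : ∃ σ, 0 < σ ∧ σ ≤ a / 8 ∧ σ ≤ ε / 16 :=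
    ⟨min (a / 8) (ε / 16), by positivity, min_le_left _ _, min_le_right _ _⟩
  set C : Set (E × E) := Metric.closedBall p ρ ×ˢ Metric.closedBall p ρ with hC
  have hpρ : p ∈ Metric.closedBall p ρ := Metric.mem_closedBall_self hρ0.le
  have hβc := hβ.contDiff.continuous
  -- Bumps are maximal at the origin, so subtracting them penalizes distance. The height `4 * η`
  -- exceeds the total variation `3 * η` of the other terms by enough to absorb `ψ`.
  set w : E × E → ℝ := fun z => F z.1 + (G z.2 - H z.1 - a * β (r⁻¹ • (z.1 - p)) -
    4 * η * β (s⁻¹ • (z.1 - z.2))) with hw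
  have hwl : LowerSemicontinuousOn w C := by
    refine LowerSemicontinuousOn.add (f := fun z : E × E => F z.1) ?_
      (ContinuousOn.lowerSemicontinuousOn ?_)
    · intro z hz y hy
      exact ((continuous_fst.tendsto z).mono_left nhdsWithin_le_nhds).eventually
        ((hρ hz.1).1 y hy)
    · refine ContinuousOn.sub (ContinuousOn.sub (ContinuousOn.sub ?_ ?_) ?_) ?_
      · exact hG.continuousOn.comp continuousOn_snd fun z hz => (hρ hz.2).2.2.1
      · exact ContinuousOn.comp (t := Metric.closedBall p ρ)
          (fun y hy => (hρ hy).2.1.continuousAt.continuousWithinAt) continuousOn_fst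
          fun z hz => hz.1
      · fun_prop
      · fun_prop
  have hwb : ∀ z ∈ C, F p + G p - H p - 3 * η - a - 4 * η ≤ w z := by
    intro z hz
    obtain ⟨-, -, -, -, -, h1, -, h2, -⟩ := hρ hz.1
    obtain ⟨-, -, -, -, -, -, h3, -, -⟩ := hρ hz.2
    rw [abs_lt] at h2 h3
    have b1 := mul_le_of_le_one_right ha0.le (hβ.le_one (r⁻¹ • (z.1 - p)))
    have b2 := mul_le_of_le_one_right (by positivity : 0 ≤ 4 * η)
      (hβ.le_one (s⁻¹ • (z.1 - z.2)))
    simp only [hw]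
    linarith
  obtain ⟨ψ, hψc, hψn, hψd, ⟨u, v⟩, ⟨hu, hv⟩, hminψ⟩ := (hβ.prod hβ).exists_contDiff_isMinOn
    (Metric.isClosed_closedBall.prod Metric.isClosed_closedBall) ⟨(p, p), hpρ, hpρ⟩ hwl hwb hσ0
  simp only at hu hv
  obtain ⟨-, uH, uV, uU, u1, u2, -, u3, u4⟩ := hρ hu
  obtain ⟨-, -, vV, vU, -, -, v3, -, -⟩ := hρ hv
  have hpp := hminψ (p, p) ⟨hpρ, hpρ⟩
  simp only [hw, sub_self, smul_zero, hβ.map_zero, mul_one] at hpp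
  have hψ1 := abs_le.1 (hψn (u, v))
  have hψ2 := abs_le.1 (hψn (p, p))
  have b1 := mul_le_of_le_one_right ha0.le (hβ.le_one (r⁻¹ • (u - p)))
  have b2 := mul_le_of_le_one_right (by positivity : 0 ≤ 4 * η) (hβ.le_one (s⁻¹ • (u - v)))
  have u3' := abs_lt.1 u3
  have v3' := abs_lt.1 v3
  have hscale : ∀ t : ℝ, 0 < t → ∀ e : E, β (t⁻¹ • e) ≠ 0 → ‖e‖ < t := by
    intro t ht e he
    by_contra! hle
    refine he (hβ.eq_zero _ ?_)
    rw [norm_smul, norm_inv, Real.norm_eq_abs, abs_of_pos ht, inv_mul_eq_div, one_le_div ht]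
    exact hle
  -- Otherwise the comparison with `(p, p)` gives `η ≤ 2 * σ ≤ η / 4`.
  have huv : ‖u - v‖ < s := by
    refine hscale s hs0 _ fun h0 => ?_
    rw [h0] at hpp
    linarith
  have hGuv : |G u - G v| < a / 4 :=
    hδ u uV v vV (by rw [dist_eq_norm]; exact huv.trans_le hsδ)
  -- Replacing `G v` by `G u` costs at most `a / 4`, after which minimality of `p` applies; leaving
  -- the bump's support would give `3 * a / 4 ≤ 2 * σ ≤ a / 4`.
  have hup : ‖u - p‖ < r := by
    refine hscale r hr0 _ fun h0 => ?_
    rw [h0] at hpp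
    linarith [(abs_lt.1 hGuv).2]
  have hvp : ‖v - p‖ < ρ := by
    have := norm_sub_le (u - p) (u - v)
    rw [sub_sub_sub_cancel_left] at this
    linarith
  have hψ' : HasFDerivAt ψ (fderiv ℝ ψ (u, v)) (u, v) :=
    (hψc.differentiable (by norm_num) _).hasFDerivAt
  set D := fderiv ℝ β (s⁻¹ • (u - v)) with hD
  set T := fderiv ℝ β (r⁻¹ • (u - p)) with hT
  have hDL : ‖D‖ ≤ L := hβ.norm_fderiv_le _
  have hTL : ‖T‖ ≤ L := hβ.norm_fderiv_le _
  set P := (fderiv ℝ ψ (u, v)).comp (ContinuousLinearMap.inl ℝ E E) with hP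
  set Q := (fderiv ℝ ψ (u, v)).comp (ContinuousLinearMap.inr ℝ E E) with hQ
  have hPσ : ‖P‖ ≤ σ := ((ContinuousLinearMap.opNorm_comp_le _ _).trans
    (mul_le_of_le_one_right (norm_nonneg _) (ContinuousLinearMap.norm_inl_le_one _ _ _))).trans
    (hψd _)
  have hQσ : ‖Q‖ ≤ σ := ((ContinuousLinearMap.opNorm_comp_le _ _).trans
    (mul_le_of_le_one_right (norm_nonneg _) (ContinuousLinearMap.norm_inr_le_one _ _ _))).trans
    (hψd _)
  set h : E → ℝ := fun y => H y + a * β (r⁻¹ • (y - p)) + 4 * η * β (s⁻¹ • (y - v)) + ψ (y, v)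
    with hh
  set k : E → ℝ := fun y => 4 * η * β ((-s⁻¹) • (y - u)) + ψ (u, y) with hk
  have hneg : ∀ y, (-s⁻¹) • (y - u) = s⁻¹ • (u - y) := fun y => by
    rw [neg_smul, ← smul_neg, neg_sub]
  have hhd : fderiv ℝ h u = fderiv ℝ H u + a • (r⁻¹ • T) + (4 * η) • (s⁻¹ • D) + P := by
    refine HasFDerivAt.fderiv (HasFDerivAt.add (HasFDerivAt.add (HasFDerivAt.add ?_ ?_) ?_) ?_)
    · exact (uH.differentiableAt (by norm_num)).hasFDerivAt
    · exact (hβ.hasFDerivAt_scale _ _ _).const_mul a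
    · exact (hβ.hasFDerivAt_scale _ _ _).const_mul (4 * η)
    · exact hψ'.comp u (hasFDerivAt_prodMk_left u v)
  have hkd : fderiv ℝ k v = (4 * η) • ((-s⁻¹) • D) + Q := by
    refine HasFDerivAt.fderiv (HasFDerivAt.add ?_ ?_)
    · rw [hD, ← hneg]
      exact (hβ.hasFDerivAt_scale _ _ _).const_mul (4 * η)
    · exact hψ'.comp v (hasFDerivAt_prodMk_right u v)
  have nT : ‖a • (r⁻¹ • T)‖ ≤ ε / 16 := by
    rw [norm_smul, norm_smul, norm_inv, Real.norm_eq_abs, Real.norm_eq_abs, abs_of_pos ha0,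
      abs_of_pos hr0]
    calc a * (r⁻¹ * ‖T‖) ≤ a * (r⁻¹ * L) := by gcongr
      _ = r⁻¹ * (a * L) := by ring
      _ ≤ _ := har
  have nD : s * ‖(4 * η) • (s⁻¹ • D)‖ ≤ ε / 4 := by
    rw [norm_smul, norm_smul, norm_inv, Real.norm_eq_abs, Real.norm_eq_abs,
      abs_of_pos (by positivity : 0 < 4 * η), abs_of_pos hs0]
    calc s * (4 * η * (s⁻¹ * ‖D‖)) = 4 * η * ‖D‖ := by field_simp
      _ ≤ 4 * η * L := by gcongr
      _ ≤ _ := by linarith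
  have nD' : ‖(4 * η) • ((-s⁻¹) • D)‖ = ‖(4 * η) • (s⁻¹ • D)‖ := by
    rw [neg_smul, smul_neg, norm_neg]
  have nH : ‖fderiv ℝ H u‖ ≤ ‖fderiv ℝ H p‖ + ε / 4 := by
    linarith [norm_le_insert' (fderiv ℝ H u) (fderiv ℝ H p)]
  refine ⟨u, uU, v, vU, h, k, ?_, ?_, ?_, ?_, ?_, ?_, ?_, ?_⟩
  · have := hβ.contDiff
    refine ContDiffAt.add (ContDiffAt.add (ContDiffAt.add uH ?_) ?_) ?_
    all_goals exact ContDiff.contDiffAt (by fun_prop)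
  · have := hβ.contDiff
    exact ContDiff.contDiffAt (by fun_prop)
  · have : ∀ᶠ y in 𝓝 u, y ∈ Metric.closedBall p ρ :=
      Metric.closedBall_mem_nhds_of_mem (by rw [mem_ball_iff_norm]; linarith)
    filter_upwards [this] with y hy
    have := hminψ (y, v) ⟨hy, hv⟩
    simp only [hw] at this
    simp only [hh]
    linarith
  · have : ∀ᶠ y in 𝓝 v, y ∈ Metric.closedBall p ρ :=
      Metric.closedBall_mem_nhds_of_mem (by rwa [mem_ball_iff_norm])
    filter_upwards [this] with y hy
    have := hminψ (u, y) ⟨hu, hy⟩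
    simp only [hw] at this
    simp only [hk, hneg]
    linarith
  -- Semicontinuity bounds `F u` only from below; the upper bound comes from the comparison with
  -- `(p, p)`.
  · rw [abs_lt]
    constructor <;> linarith
  · linarith
  -- The two large coupling terms in `D` cancel here.
  · have : fderiv ℝ h u + fderiv ℝ k v - fderiv ℝ H p =
        (fderiv ℝ H u - fderiv ℝ H p) + a • (r⁻¹ • T) + (P + Q) := by
      rw [hhd, hkd, neg_smul, smul_neg]
      abel
    rw [this]
    have t1 := norm_add₃_le (a := fderiv ℝ H u - fderiv ℝ H p) (b := a • (r⁻¹ • T)) (c := P + Q)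
    linarith [norm_add_le P Q]
  · have m1 : max ‖fderiv ℝ h u‖ ‖fderiv ℝ k v‖ ≤
        ‖fderiv ℝ H p‖ + ε + ‖(4 * η) • (s⁻¹ • D)‖ := by
      refine max_le ?_ ?_
      · rw [hhd]
        linarith [norm_add_le (fderiv ℝ H u + a • (r⁻¹ • T) + (4 * η) • (s⁻¹ • D)) P,
          norm_add₃_le (a := fderiv ℝ H u) (b := a • (r⁻¹ • T)) (c := (4 * η) • (s⁻¹ • D))]
      · rw [hkd]
        linarith [norm_add_le ((4 * η) • ((-s⁻¹) • D)) Q, norm_nonneg (fderiv ℝ H p)]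
    have : ‖u - v‖ * max ‖fderiv ℝ h u‖ ‖fderiv ℝ k v‖ ≤
        s * (‖fderiv ℝ H p‖ + ε + ‖(4 * η) • (s⁻¹ • D)‖) := by gcongr
    linarith

/-! ### Transfer of subdifferentials between chart and manifold. -/

section Manifold

variable {X : Type*} [NormedAddCommGroup X] [NormedSpace ℝ X]
  {M : Type*} [TopologicalSpace M] [ChartedSpace X M]

theorem chartInvDeriv_symm_apply {φ : OpenPartialHomeomorph M X} {u : X} (hu : u ∈ φ.target) :
    chartInvDeriv φ (φ.symm u) = mfderiv 𝓘(ℝ, X) 𝓘(ℝ, X) φ.symm u := by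
  unfold chartInvDeriv
  rw [φ.right_inv hu]

variable {φ : OpenPartialHomeomorph M X}

theorem mfderiv_comp_chartInvDeriv (hφ : φ ∈ IsManifold.maximalAtlas 𝓘(ℝ, X) 1 M) {u : X}
    (hu : u ∈ φ.target) {h : M → ℝ} (hh : ContMDiff 𝓘(ℝ, X) 𝓘(ℝ, ℝ) 1 h)
    {Δ : TangentSpace 𝓘(ℝ, X) (φ.symm u) →L[ℝ] ℝ}
    (hΔ : Δ = mfderiv 𝓘(ℝ, X) 𝓘(ℝ, ℝ) h (φ.symm u)) :
    Δ.comp (chartInvDeriv φ (φ.symm u)) = fderiv ℝ (fun y => h (φ.symm y)) u := by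
  subst hΔ
  rw [chartInvDeriv_symm_apply hu, ← mfderiv_eq_fderiv]
  exact (mfderiv_comp u ((hh _).mdifferentiableAt (by norm_num))
    ((contMDiffAt_symm_of_mem_maximalAtlas hφ hu).mdifferentiableAt (by norm_num))).symm

theorem contDiffAt_comp_chart_symm (hφ : φ ∈ IsManifold.maximalAtlas 𝓘(ℝ, X) 1 M) {u : X}
    (hu : u ∈ φ.target) {h : M → ℝ} (hh : ContMDiff 𝓘(ℝ, X) 𝓘(ℝ, ℝ) 1 h) :
    ContDiffAt ℝ 1 (fun y => h (φ.symm y)) u :=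
  contMDiffAt_iff_contDiffAt.1 ((hh _).comp u (contMDiffAt_symm_of_mem_maximalAtlas hφ hu))

/-- On a manifold modeled on a space with a `C¹` bump, germs of `C¹` functions extend. -/
theorem exists_contMDiff_eventuallyEq_comp_chart [RegularSpace M] {β : X → ℝ} {L : ℝ}
    (hβ : IsUnitBump β L) (hφ : φ ∈ IsManifold.maximalAtlas 𝓘(ℝ, X) 1 M) {u : X}
    (hu : u ∈ φ.target) {k : X → ℝ} (hk : ContDiffAt ℝ 1 k u) :
    ∃ h : M → ℝ, ContMDiff 𝓘(ℝ, X) 𝓘(ℝ, ℝ) 1 h ∧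
      ∀ᶠ y in 𝓝 (φ.symm u), h y = k (φ y) := by
  classical
  -- The closed set `N` keeps the support of the cutoff away from the boundary of the chart domain,
  -- so that the extension by zero is `C¹` there.
  obtain ⟨N, hN, hNc, hNs⟩ := exists_mem_nhds_isClosed_subset
    (φ.open_source.mem_nhds (φ.map_target hu))
  have hev : ∀ᶠ y in 𝓝 u, φ.symm y ∈ N ∧ ContDiffAt ℝ 1 k y :=
    ((φ.continuousAt_symm hu).eventually hN).and (hk.eventually (by simp))
  obtain ⟨r, hr0, hr⟩ := Metric.nhds_basis_closedBall.mem_iff.1 hev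
  -- A bump need not be constant near its centre. This cutoff is 1 where `β ≥ 2/3`, hence near `u`,
  -- and 0 where `β ≤ 1/3`.
  set χ : X → ℝ := fun y => Real.smoothTransition (3 * β (r⁻¹ • (y - u)) - 1) with hχ
  have hχc : ContDiff ℝ 1 χ := by
    have := hβ.contDiff
    exact Real.smoothTransition.contDiff.comp (by fun_prop)
  have hχ0 : ∀ y, y ∉ Metric.closedBall u r → χ y = 0 := by
    intro y hy
    have : β (r⁻¹ • (y - u)) = 0 := by
      refine hβ.eq_zero _ ?_
      rw [mem_closedBall_iff_norm, not_le] at hy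
      rw [norm_smul, norm_inv, Real.norm_eq_abs, abs_of_pos hr0, inv_mul_eq_div, one_le_div hr0]
      exact hy.le
    exact Real.smoothTransition.zero_of_nonpos (by rw [this]; norm_num)
  have hχ1 : ∀ᶠ y in 𝓝 u, χ y = 1 := by
    have hc : ContinuousAt (fun y => 3 * β (r⁻¹ • (y - u)) - 1) u := by
      have := hβ.contDiff.continuous
      fun_prop
    have : (1 : ℝ) < 3 * β (r⁻¹ • (u - u)) - 1 := by
      rw [sub_self, smul_zero, hβ.map_zero]
      norm_num
    filter_upwards [hc.eventually_const_lt this] with y hy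
    exact Real.smoothTransition.one_of_one_le hy.le
  have hχk : ContDiff ℝ 1 fun y => χ y * k y := by
    rw [contDiff_iff_contDiffAt]
    intro y
    by_cases hy : y ∈ Metric.closedBall u r
    · exact hχc.contDiffAt.mul (hr hy).2
    · refine (contDiffAt_const (c := (0 : ℝ))).congr_of_eventuallyEq ?_
      filter_upwards [Metric.isClosed_closedBall.isOpen_compl.mem_nhds hy] with z hz
      rw [hχ0 z hz, zero_mul]
  refine ⟨fun m => if m ∈ φ.source then χ (φ m) * k (φ m) else 0, fun m => ?_, ?_⟩
  · by_cases hm : m ∈ φ.source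
    · have h1 : ContMDiffAt 𝓘(ℝ, X) 𝓘(ℝ, ℝ) 1 (fun m => χ (φ m) * k (φ m)) m :=
        hχk.contMDiff.contMDiffAt.comp m (contMDiffAt_of_mem_maximalAtlas hφ hm)
      refine h1.congr_of_eventuallyEq ?_
      filter_upwards [φ.open_source.mem_nhds hm] with y hy
      rw [if_pos hy]
    · refine (contMDiffAt_const (c := (0 : ℝ))).congr_of_eventuallyEq ?_
      filter_upwards [hNc.isOpen_compl.mem_nhds fun h => hm (hNs h)] with y hy
      split_ifs with hys
      · rw [hχ0, zero_mul]
        intro hmem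
        have := (hr hmem).1
        rw [φ.left_inv hys] at this
        exact hy this
      · rfl
  · have ht : Tendsto φ (𝓝 (φ.symm u)) (𝓝 u) := by
      simpa only [ContinuousAt, φ.right_inv hu] using φ.continuousAt (φ.map_target hu)
    filter_upwards [φ.open_source.mem_nhds (φ.map_target hu), ht.eventually hχ1] with y hy hy1
    rw [if_pos hy, hy1, one_mul]

/-- A test function in the chart is only a germ, whereas `subdifferential` asks for a global one;
the extension has the same germ, hence the same local minimum and derivative. -/
theorem exists_mem_subdifferential_of_chart [RegularSpace M] {β : X → ℝ} {L : ℝ}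
    (hβ : IsUnitBump β L) (hφ : φ ∈ IsManifold.maximalAtlas 𝓘(ℝ, X) 1 M) {u : X}
    (hu : u ∈ φ.target) {f : M → ℝ} {k : X → ℝ} (hk : ContDiffAt ℝ 1 k u)
    (hmin : IsLocalMin (fun y => f (φ.symm y) - k y) u) :
    ∃ Δ ∈ subdifferential X f (φ.symm u),
      Δ.comp (chartInvDeriv φ (φ.symm u)) = fderiv ℝ k u := by
  obtain ⟨h, hh, hhk⟩ := exists_contMDiff_eventuallyEq_comp_chart hβ hφ hu hk
  have ht : Tendsto φ (𝓝 (φ.symm u)) (𝓝 u) := by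
    simpa only [ContinuousAt, φ.right_inv hu] using φ.continuousAt (φ.map_target hu)
  refine ⟨_, ⟨h, hh, ?_, rfl⟩, ?_⟩
  · filter_upwards [ht.eventually hmin, hhk, φ.open_source.mem_nhds (φ.map_target hu)]
      with y hy1 hy2 hy3
    rw [φ.left_inv hy3] at hy1
    rwa [hhk.self_of_nhds, hy2, φ.right_inv hu]
  · refine (mfderiv_comp_chartInvDeriv hφ hu hh rfl).trans ?_
    refine Filter.EventuallyEq.fderiv_eq ?_
    filter_upwards [(φ.continuousAt_symm hu).eventually hhk, φ.open_target.mem_nhds hu]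
      with y hy1 hy2
    rw [hy1, φ.right_inv hy2]

/-! ### The Finsler metric in a chart. -/

theorem velocity_chart_symm_lineMap (hφ : φ ∈ IsManifold.maximalAtlas 𝓘(ℝ, X) 1 M) {y z : X}
    {t : ℝ} (ht : AffineMap.lineMap y z t ∈ φ.target) :
    velocity X (fun s : ℝ => φ.symm (AffineMap.lineMap y z s)) t =
      chartInvDeriv φ (φ.symm (AffineMap.lineMap y z t)) (z - y) := by
  rw [chartInvDeriv_symm_apply ht]
  have h1 : HasDerivAt (AffineMap.lineMap y z : ℝ → X) (z - y) t := AffineMap.hasDerivAt_lineMap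
  have h2 := ((contMDiffAt_symm_of_mem_maximalAtlas hφ ht).mdifferentiableAt
    (by norm_num)).hasMFDerivAt.comp t h1.hasFDerivAt.hasMFDerivAt
  have h3 : velocity X (fun s : ℝ => φ.symm (AffineMap.lineMap y z s)) t =
    ((mfderiv 𝓘(ℝ, X) 𝓘(ℝ, X) φ.symm (AffineMap.lineMap y z t)).comp
      (ContinuousLinearMap.toSpanSingleton ℝ (z - y)) : ℝ →L[ℝ] X) (1 : ℝ) :=
    congrArg (fun T : ℝ →L[ℝ] X => T 1) h2.mfderiv
  rw [h3]
  exact congrArg (mfderiv 𝓘(ℝ, X) 𝓘(ℝ, X) φ.symm (AffineMap.lineMap y z t)) (one_smul ℝ (z - y))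

variable [IsManifold 𝓘(ℝ, X) 1 M]

theorem FinslerStructure.dist_le_length (F : FinslerStructure X M) {c : ℝ → M} {a b : ℝ}
    (hab : a ≤ b) (hc : IsPiecewiseC1Path X c a b) : F.dist (c a) (c b) ≤ F.length c a b := by
  refine csInf_le ⟨0, ?_⟩ ⟨c, a, b, hab, hc, rfl, rfl, rfl⟩
  rintro _ ⟨c, a, b, hab, -, -, -, rfl⟩
  exact intervalIntegral.integral_nonneg hab fun t _ => apply_nonneg _ _

/-- The Finsler metric is locally bounded by a multiple of the norm in a chart. -/
theorem FinslerStructure.exists_dist_chart_symm_le (F : FinslerStructure X M)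
    (hφ : φ ∈ IsManifold.maximalAtlas 𝓘(ℝ, X) 1 M) {x : M} (hx : x ∈ φ.source) :
    ∃ K : ℝ, 0 ≤ K ∧ ∃ W ∈ 𝓝 (φ x), W ⊆ φ.target ∧
      ∀ y ∈ W, ∀ z ∈ W, F.dist (φ.symm y) (φ.symm z) ≤ K * ‖y - z‖ := by
  obtain ⟨K, hK1, hK⟩ := F.equivalent φ hφ x hx
  -- With `ε = 1` the norms near `x` are at most twice the one at `x`, so the image of a segment has
  -- length at most `2 * K` times its norm.
  obtain ⟨V, hVo, hxV, hVs, hV⟩ := F.palais φ hφ x hx 1 one_pos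
  have hev : ∀ᶠ y in 𝓝 (φ x), y ∈ φ.target ∧ φ.symm y ∈ V := by
    refine Filter.Eventually.and (φ.open_target.mem_nhds (φ.map_source hx))
      ((φ.continuousAt_symm (φ.map_source hx)).eventually ?_)
    rw [φ.left_inv hx]
    exact hVo.mem_nhds hxV
  obtain ⟨r, hr0, hr⟩ := Metric.nhds_basis_ball.mem_iff.1 hev
  refine ⟨2 * K, by linarith, Metric.ball (φ x) r, Metric.ball_mem_nhds _ hr0,
    fun y hy => (hr hy).1, fun y hy z hz => ?_⟩
  have hseg : ∀ t ∈ Icc (0 : ℝ) 1, AffineMap.lineMap y z t ∈ Metric.ball (φ x) r :=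
    fun t ht => (convex_ball _ _).lineMap_mem hy hz ht
  set c : ℝ → M := fun t => φ.symm (AffineMap.lineMap y z t) with hc
  have hcs : ContMDiffOn 𝓘(ℝ, ℝ) 𝓘(ℝ, X) 1 c (Icc 0 1) :=
    (contMDiffOn_symm_of_mem_maximalAtlas hφ).comp
      (ContDiff.contMDiff (f := (AffineMap.lineMap y z : ℝ → X)) (by
        rw [funext (AffineMap.lineMap_apply_module' y z)]; fun_prop)).contMDiffOn
      fun t ht => (hr (hseg t ht)).1
  have hpath : IsPiecewiseC1Path X c 0 1 := by
    refine ⟨hcs.continuousOn, 1, fun i => i, by simp, by simp, fun i hi => ?_⟩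
    obtain rfl : i = 0 := by omega
    simpa using hcs
  have hle := F.dist_le_length zero_le_one hpath
  have hlen : F.length c 0 1 ≤ 2 * K * ‖y - z‖ := by
    refine (Real.le_norm_self _).trans ?_
    have := intervalIntegral.norm_integral_le_of_norm_le_const
      (f := fun t => F.norm (c t) (velocity X c t)) (a := 0) (b := 1) (C := 2 * K * ‖y - z‖) ?_
    · simpa [FinslerStructure.length] using this
    · intro t ht
      rw [uIoc_of_le zero_le_one] at ht
      have htb := hr (hseg t (Ioc_subset_Icc_self ht))
      rw [Real.norm_eq_abs, abs_of_nonneg (apply_nonneg _ _),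
        velocity_chart_symm_lineMap hφ htb.1, norm_sub_rev]
      linarith [(hV _ htb.2 (z - y)).2, (hK (z - y)).2]
  simpa [hc] using hle.trans hlen

end Manifold

/-! ### The fuzzy sum rule on the manifold. -/

theorem mainTheorem8 {X : Type*} [NormedAddCommGroup X] [NormedSpace ℝ X] [CompleteSpace X]
    (hX : HasC1LipschitzBump X)
    {M : Type*} [TopologicalSpace M] [ChartedSpace X M] [IsManifold 𝓘(ℝ, X) 1 M]
    [T2Space M] [ParacompactSpace M] [ConnectedSpace M]
    (F : FinslerStructure X M)
    (f g : M → ℝ) (hf : LowerSemicontinuous f) (hg : F.LocallyUniformlyContinuous g)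
    (x : M) (φ : OpenPartialHomeomorph M X) (hφ : φ ∈ IsManifold.maximalAtlas 𝓘(ℝ, X) 1 M)
    (hx : x ∈ φ.source)
    (Δ : TangentSpace 𝓘(ℝ, X) x →L[ℝ] ℝ) (hΔ : Δ ∈ subdifferential X (fun y => f y + g y) x)
    (ε : ℝ) (hε : 0 < ε) :
    ∃ x₁ ∈ φ.source, ∃ x₂ ∈ φ.source,
      ∃ Δ₁ ∈ subdifferential X f x₁, ∃ Δ₂ ∈ subdifferential X g x₂,
        (F.dist x₁ x < ε ∧ F.dist x₂ x < ε) ∧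
        (|f x₁ - f x| < ε ∧ |g x₂ - g x| < ε) ∧
        ‖Δ₁.comp (chartInvDeriv φ x₁) + Δ₂.comp (chartInvDeriv φ x₂)
          - Δ.comp (chartInvDeriv φ x)‖ < ε ∧
        F.dist x₁ x₂ *
          max ‖Δ₁.comp (chartInvDeriv φ x₁)‖ ‖Δ₂.comp (chartInvDeriv φ x₂)‖ < ε := by
  -- Writing `x` as `φ.symm p` makes the tangent space of `Δ` the one in the transfer lemmas.
  obtain ⟨p, hp, rfl⟩ : ∃ p ∈ φ.target, φ.symm p = x := ⟨φ x, φ.map_source hx, φ.left_inv hx⟩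
  obtain ⟨h, hh, hmin, hΔ⟩ := hΔ
  obtain ⟨β, L, -, hβ⟩ := hX.exists_isUnitBump
  obtain ⟨K, hK0, W, hW, hWt, hWK⟩ := F.exists_dist_chart_symm_le hφ hx
  rw [φ.right_inv hp] at hW
  obtain ⟨V, hV, hVg⟩ := hg (φ.symm p)
  have hpc : Tendsto φ.symm (𝓝 p) (𝓝 (φ.symm p)) := φ.continuousAt_symm hp
  -- Dividing by `K + 1` makes both `ε'` and `K * ε'` at most `ε`, even if `K = 0`.
  obtain ⟨ε', hε'0, hε'⟩ : ∃ ε', 0 < ε' ∧ (K + 1) * ε' = ε :=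
    ⟨ε / (K + 1), by positivity, by field_simp⟩
  have hε'ε : ε' ≤ ε := by nlinarith
  have hKε : K * ε' ≤ ε := by nlinarith
  have hlsc : ∀ᶠ y in 𝓝 p, LowerSemicontinuousAt (fun y => f (φ.symm y)) y := by
    filter_upwards [φ.open_target.mem_nhds hp] with y hy a ha
    exact (φ.continuousAt_symm hy).eventually (hf _ a ha)
  have huc : UniformContinuousOn (fun y => g (φ.symm y)) (W ∩ φ.symm ⁻¹' V) := by
    rw [Metric.uniformContinuousOn_iff]
    intro e he
    obtain ⟨δ, hδ0, hδ⟩ := hVg e he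
    refine ⟨δ / (K + 1), by positivity, fun y hy z hz hyz => hδ _ hy.2 _ hz.2 ?_⟩
    rw [dist_eq_norm, lt_div_iff₀ (by positivity)] at hyz
    nlinarith [hWK y hy.1 z hz.1, norm_nonneg (y - z)]
  have hUn : W ∩ Metric.ball p ε' ∈ 𝓝 p := inter_mem hW (Metric.ball_mem_nhds _ hε'0)
  obtain ⟨u, hu, v, hv, h₁, h₂, hc₁, hc₂, hm₁, hm₂, hf₁, hg₂, hsum, hprod⟩ :=
    hβ.fuzzy_sum_rule hlsc (inter_mem hW (hpc hV)) huc (contDiffAt_comp_chart_symm hφ hp hh)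
      (hpc.eventually hmin) hUn hε'0
  obtain ⟨Δ₁, hΔ₁, e₁⟩ := exists_mem_subdifferential_of_chart hβ hφ (hWt hu.1) hc₁ hm₁
  obtain ⟨Δ₂, hΔ₂, e₂⟩ := exists_mem_subdifferential_of_chart hβ hφ (hWt hv.1) hc₂ hm₂
  have hd : ∀ w ∈ W ∩ Metric.ball p ε', F.dist (φ.symm w) (φ.symm p) < ε := by
    intro w hw
    have h1 := mem_ball_iff_norm.1 hw.2
    nlinarith [hWK w hw.1 p (mem_of_mem_nhds hW), norm_nonneg (w - p)]
  refine ⟨_, φ.map_target (hWt hu.1), _, φ.map_target (hWt hv.1), Δ₁, hΔ₁, Δ₂, hΔ₂,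
    ⟨hd u hu, hd v hv⟩, ⟨hf₁.trans_le hε'ε, hg₂.trans_le hε'ε⟩, ?_, ?_⟩
  · rw [e₁, e₂, mfderiv_comp_chartInvDeriv hφ hp hh hΔ]
    exact hsum.trans_le hε'ε
  · rw [e₁, e₂]
    have hm : 0 ≤ max ‖fderiv ℝ h₁ u‖ ‖fderiv ℝ h₂ v‖ := (norm_nonneg _).trans (le_max_left _ _)
    have := mul_le_mul_of_nonneg_right (hWK u hu.1 v hv.1) hm
    rw [mul_assoc] at this
    nlinarith
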